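/- Let $(G,c)$ be an infinite resistance network: $G$ is an infinite vertex set, $c:G\times G\to[0,\infty)$ is symmetric with $c_{xx}=0$ and $c(x)=\sum_y c_{xy}<\infty$ for every $x$ (infinite degrees are allowed), and the graph with $x\sim y$ iff $c_{xy}>0$ is connected. For real functions on $G$ put $(\Delta u)(x)=\sum_y c_{xy}(u(x)-u(y))$ and $\mathcal E(u,v)=\frac12\sum_{x,y}c_{xy}(u(x)-u(y))(v(x)-v(y))$, $\mathcal E(u)=\mathcal E(u,u)$, $\operatorname{dom}\mathcal E=\{u:\mathcal E(u)<\infty\}$. Let $\mathcal H_{\mathcal E}=\operatorname{dom}\mathcal E/\{\text{constants}\}$, a Hilbert space with inner product $\mathcal E$. Let $\mathrm{Fin}\subseteq\mathcal H_{\mathcal E}$ be the closure of the span of the (classes of the) Dirac masses $\delta_x$, and $\mathrm{Harm}=\{u\in\mathcal H_{\mathcal E}:\Delta u=0\}$. Fix $o\in G$; let $v_x\in\mathcal H_{\mathcal E}$ be the element with $\mathcal E(v_x,u)=u(x)-u(o)$ for all $u\in\mathcal H_{\mathcal E}$, and let $h_x$ be the orthogonal projection of $v_x$ to $\mathrm{Harm}$.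 For $x,y\in G$ let $L_{xy}:\mathcal H_{\mathcal E}\to\mathbb R$, $L_{xy}u=u(x)-u(y)$. For a finite connected network containing $x,y$, the effective resistance between $x$ and $y$ is $v(x)-v(y)$, where $\Delta v=\delta_x-\delta_y$ on that network. Let $(G_k)$ be an exhaustion of $G$: an increasing sequence of finite connected full subnetworks with union $G$. Let $R_{G_k^F}(x,y)$ be the effective resistance in $G_k$, and $R_{G_k^W}(x,y)$ the effective resistance in the network obtained by identifying all vertices outside $G_k$ to a single vertex $\infty_k$, with $c_{z\infty_k}=\sum_{w\notin G_k}c_{zw}$ for $z\in G_k$. Put $R^F(x,y)=\lim_k R_{G_k^F}(x,y)$ and $R^W(x,y)=\lim_k R_{G_k^W}(x,y)$. Theorem. Exhaustions exist, and for all $x,y\in G$ both limits exist and do not depend on the exhaustion. The harmonic resistance $R^{\mathrm{ha}}(x,y):=R^F(x,y)-R^W(x,y)$ satisfies $$\begin{aligned} R^{\mathrm{ha}}(x,y)&=(h_x(x)-h_x(y))-(h_y(x)-h_y(y))\\ &=\mathcal E(h_x-h_y)\\ &=\inf\{\kappa\ge 0: |h(x)-h(y)|^2\le\kappa\,\mathcal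 E(h)\ \text{for all } h\in\mathrm{Harm}\}\\ &=\sup\{|h(x)-h(y)|^2: h\in\mathrm{Harm},\ \mathcal E(h)\le 1\}\\ &=\big\|L_{xy}|_{\mathrm{Harm}}\big\|^2, \end{aligned}$$ and, if $x\ne y$, $$R^{\mathrm{ha}}(x,y)=\frac1{\min\{\mathcal E(v): v\in\operatorname{dom}\mathcal E,\ v(x)=1,\ v(y)=0\}}-\frac1{\min\{\mathcal E(f): f\in\mathrm{Fin},\ f(x)=1,\ f(y)=0\}},$$ where both minima are attained and positive (here $f\in\mathrm{Fin}$ means a function whose class lies in $\mathrm{Fin}$). -/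

import Mathlib

/-- A resistance network on the vertex set `V`: a symmetric nonnegative conductance function
without loops, of finite total conductance at every vertex (infinitely many neighbours are
allowed), whose graph (`x ~ y` iff `0 < c x y`) is connected. -/
structure ResistanceNetwork (V : Type*) where
  c : V → V → ℝ
  symm : ∀ x y, c x y = c y x
  nonneg : ∀ x y, 0 ≤ c x y
  loopless : ∀ x, c x x = 0
  summable : ∀ x, Summable (c x)
  connected : ∀ x y, Relation.ReflTransGen (fun a b => 0 < c a b) x y

/-- The Dirac mass at `x`. -/
noncomputable def dirac {V : Type*} (x : V) : V → ℝ := Set.indicator {x} 1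

/-- The Laplacian `(Δ v)(x) = ∑_y c_xy (v x - v y)` of a conductance function. -/
noncomputable def laplacian {V : Type*} (c : V → V → ℝ) (v : V → ℝ) (x : V) : ℝ :=
  ∑' y, c x y * (v x - v y)

/-- The effective resistance of a finite network: the voltage drop `v x - v y`, where `v` is a
voltage function for one unit of current inserted at `x` and withdrawn at `y`. -/
noncomputable def effectiveResistance {W : Type*} [Finite W] (c : W → W → ℝ) (x y : W) : ℝ :=
  Classical.epsilon fun r : ℝ =>
    ∃ v : W → ℝ, (∀ z, laplacian c v z = dirac x z - dirac y z) ∧ r = v x - v y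

namespace ResistanceNetwork

variable {V : Type*} (N : ResistanceNetwork V)

/-! ### Exhaustions, free and wired resistance -/

/-- The graph of a network. -/
def graph : SimpleGraph V where
  Adj x y := 0 < N.c x y
  symm := ⟨fun x y h => by rw [N.symm y x]; exact h⟩
  loopless := ⟨fun x h => by rw [N.loopless x] at h; exact lt_irrefl _ h⟩

/-- An exhaustion by finite, connected, full subnetworks. -/
structure Exhaustion where
  verts : ℕ → Finset V
  mono : ∀ k, verts k ⊆ verts (k + 1)
  exhausts : ∀ x, ∃ k, x ∈ verts k
  connected : ∀ k, (N.graph.induce (verts k : Set V)).Connected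

/-- Conductances of the free subnetwork (that is, the full subnetwork) on `H`. -/
def freeConductance (H : Finset V) (a b : H) : ℝ := N.c a b

/-- Conductances of the wired subnetwork of `H`: all vertices outside `H` are identified to one
new vertex `none`. -/
noncomputable def wiredConductance (H : Finset V) : Option H → Option H → ℝ
  | some a, some b => N.c a b
  | some a, none => ∑' z : {z : V // z ∉ H}, N.c a z
  | none, some b => ∑' z : {z : V // z ∉ H}, N.c b z
  | none, none => 0

open Classical in
/-- `R_{H^F}(x, y)`, for `x, y ∈ H` (set to `0` otherwise). -/
noncomputable def freeResistanceOn (H : Finset V) (x y : V) : ℝ :=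
  if h : x ∈ H ∧ y ∈ H then
    effectiveResistance (N.freeConductance H) ⟨x, h.1⟩ ⟨y, h.2⟩ else 0

open Classical in
/-- `R_{H^W}(x, y)`, for `x, y ∈ H` (set to `0` otherwise). -/
noncomputable def wiredResistanceOn (H : Finset V) (x y : V) : ℝ :=
  if h : x ∈ H ∧ y ∈ H then
    effectiveResistance (N.wiredConductance H) (some ⟨x, h.1⟩) (some ⟨y, h.2⟩) else 0

/-- `r` is the limit of `R_{G_k^F}(x, y)` along every exhaustion `G_k`. -/
def IsFreeResistance (x y : V) (r : ℝ) : Prop :=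
  ∀ G : N.Exhaustion,
    Filter.Tendsto (fun k => N.freeResistanceOn (G.verts k) x y) Filter.atTop (nhds r)

/-- `r` is the limit of `R_{G_k^W}(x, y)` along every exhaustion `G_k`. -/
def IsWiredResistance (x y : V) (r : ℝ) : Prop :=
  ∀ G : N.Exhaustion,
    Filter.Tendsto (fun k => N.wiredResistanceOn (G.verts k) x y) Filter.atTop (nhds r)

/-- The free resistance `R^F`. -/
noncomputable def freeResistance (x y : V) : ℝ := Classical.epsilon (N.IsFreeResistance x y)

/-- The wired resistance `R^W`. -/
noncomputable def wiredResistance (x y : V) : ℝ := Classical.epsilon (N.IsWiredResistance x y)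

/-- The harmonic resistance `R^F - R^W`. -/
noncomputable def harmonicResistance (x y : V) : ℝ :=
  N.freeResistance x y - N.wiredResistance x y

/-! ### The energy form -/

/-- The energy form. -/
noncomputable def energy (u v : V → ℝ) : ℝ :=
  (1 / 2) * ∑' p : V × V, N.c p.1 p.2 * ((u p.1 - u p.2) * (v p.1 - v p.2))

/-- The functions of finite energy. -/
def dom : Submodule ℝ (V → ℝ) where
  carrier := {u | Summable fun p : V × V => N.c p.1 p.2 * (u p.1 - u p.2) ^ 2}
  zero_mem' := by simp
  add_mem' := by
    intro u v hu hv
    refine Summable.of_nonneg_of_le (fun p => mul_nonneg (N.nonneg _ _) (sq_nonneg _)) (fun p => ?_)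
      ((hu.add hv).mul_left 2)
    have := mul_nonneg (N.nonneg p.1 p.2) (sq_nonneg ((u p.1 - u p.2) - (v p.1 - v p.2)))
    simp only [Pi.add_apply]
    nlinarith
  smul_mem' := by
    intro a u hu
    refine (Summable.mul_left (a ^ 2) hu).congr (fun p => ?_)
    simp only [Pi.smul_apply, smul_eq_mul]
    ring

theorem summable_energy {u v : V → ℝ} (hu : u ∈ N.dom) (hv : v ∈ N.dom) :
    Summable fun p : V × V => N.c p.1 p.2 * ((u p.1 - u p.2) * (v p.1 - v p.2)) := by
  refine Summable.of_norm_bounded (Summable.add hu hv) (fun p => ?_)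
  rw [Real.norm_eq_abs, abs_mul, abs_of_nonneg (N.nonneg _ _), ← mul_add]
  refine mul_le_mul_of_nonneg_left ?_ (N.nonneg _ _)
  rw [abs_le]
  constructor <;>
  nlinarith [sq_nonneg ((u p.1 - u p.2) - (v p.1 - v p.2)),
    sq_nonneg ((u p.1 - u p.2) + (v p.1 - v p.2)), sq_nonneg (u p.1 - u p.2),
    sq_nonneg (v p.1 - v p.2)]

theorem energy_comm (u v : V → ℝ) : N.energy u v = N.energy v u := by
  unfold energy
  congr 1
  exact tsum_congr fun p => by ring

theorem energy_add_left {u u' v : V → ℝ} (hu : u ∈ N.dom) (hu' : u' ∈ N.dom) (hv : v ∈ N.dom) :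
    N.energy (u + u') v = N.energy u v + N.energy u' v := by
  unfold energy
  rw [← mul_add, ← (N.summable_energy hu hv).tsum_add (N.summable_energy hu' hv)]
  congr 1
  exact tsum_congr fun p => by simp only [Pi.add_apply]; ring

theorem energy_smul_left (a : ℝ) (u v : V → ℝ) : N.energy (a • u) v = a * N.energy u v := by
  unfold energy
  rw [mul_left_comm a, ← tsum_mul_left (a := a)]
  congr 1
  exact tsum_congr fun p => by simp only [Pi.smul_apply, smul_eq_mul]; ring

theorem energy_nonneg (u : V → ℝ) : 0 ≤ N.energy u u :=
  mul_nonneg (by norm_num) (tsum_nonneg fun p =>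
    mul_nonneg (N.nonneg _ _) (mul_self_nonneg _))

theorem energy_term_le {u : V → ℝ} (hu : u ∈ N.dom) (x y : V) :
    N.c x y * (u x - u y) ^ 2 ≤ 2 * N.energy u u := by
  have h := (N.summable_energy hu hu).le_tsum (x, y) (fun p _ =>
    mul_nonneg (N.nonneg p.1 p.2) (mul_self_nonneg _))
  unfold energy
  simp only at h
  nlinarith

/-- Differences of values are bounded by the energy. -/
theorem exists_bound (x y : V) :
    ∃ K : ℝ, 0 ≤ K ∧ ∀ u ∈ N.dom, |u x - u y| ≤ K * Real.sqrt (N.energy u u) := by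
  induction N.connected x y with
  | refl => exact ⟨0, le_rfl, fun u _ => by simp⟩
  | @tail b z _ hbz ih =>
    obtain ⟨K, hK, hb⟩ := ih
    refine ⟨K + Real.sqrt (2 / N.c b z), add_nonneg hK (Real.sqrt_nonneg _), fun u hu => ?_⟩
    have h1 : |u b - u z| ≤ Real.sqrt (2 / N.c b z) * Real.sqrt (N.energy u u) := by
      rw [← Real.sqrt_mul (by positivity), ← Real.sqrt_sq_eq_abs]
      refine Real.sqrt_le_sqrt ?_
      rw [div_mul_eq_mul_div, le_div_iff₀ hbz, mul_comm]
      exact N.energy_term_le hu b z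
    calc |u x - u z| = |(u x - u b) + (u b - u z)| := by ring_nf
      _ ≤ |u x - u b| + |u b - u z| := abs_add_le _ _
      _ ≤ _ := by rw [add_mul]; exact add_le_add (hb u hu) h1

/-- The constant functions, inside the functions of finite energy. -/
def consts : Submodule ℝ N.dom where
  carrier := {u | ∃ k : ℝ, ∀ x, (u : V → ℝ) x = k}
  zero_mem' := ⟨0, fun _ => rfl⟩
  add_mem' := by
    rintro u v ⟨k, hk⟩ ⟨l, hl⟩
    exact ⟨k + l, fun x => by simp [hk x, hl x]⟩
  smul_mem' := by
    rintro a u ⟨k, hk⟩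
    exact ⟨a * k, fun x => by simp [hk x]⟩

theorem energy_of_consts {u : V → ℝ} {k : ℝ} (hu : ∀ x, u x = k) (v : V → ℝ) :
    N.energy u v = 0 := by
  simp [energy, hu]

/-! ### The energy space -/

/-- The energy space: functions of finite energy modulo constants. -/
def HE : Type _ := N.dom ⧸ N.consts

noncomputable instance : AddCommGroup N.HE := inferInstanceAs (AddCommGroup (N.dom ⧸ N.consts))
noncomputable instance : Module ℝ N.HE := inferInstanceAs (Module ℝ (N.dom ⧸ N.consts))

/-- The class of a function of finite energy. -/
noncomputable def toHE : N.dom →ₗ[ℝ] N.HE := N.consts.mkQ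

theorem toHE_surjective : Function.Surjective N.toHE := N.consts.mkQ_surjective

theorem toHE_eq_zero (u : N.dom) : N.toHE u = 0 ↔ ∃ k : ℝ, ∀ x, (u : V → ℝ) x = k :=
  Submodule.Quotient.mk_eq_zero N.consts

/-- The energy form on functions of finite energy, as a bilinear map. -/
noncomputable def energyBilin : N.dom →ₗ[ℝ] N.dom →ₗ[ℝ] ℝ :=
  LinearMap.mk₂ ℝ (fun u v => N.energy u v)
    (fun u u' v => N.energy_add_left u.2 u'.2 v.2)
    (fun a u v => N.energy_smul_left a u v)
    (fun u v v' => by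
      rw [N.energy_comm, N.energy_comm u v, N.energy_comm u v']
      exact N.energy_add_left v.2 v'.2 u.2)
    (fun a u v => by
      rw [N.energy_comm, N.energy_comm u v]
      exact N.energy_smul_left a v u)

/-- The energy form on the energy space. -/
noncomputable def innerHE : N.HE →ₗ[ℝ] N.HE →ₗ[ℝ] ℝ :=
  N.consts.liftQ
    ((N.consts.liftQ N.energyBilin.flip (by
      rintro u ⟨k, hk⟩
      ext v
      exact (N.energy_comm _ _).trans (N.energy_of_consts hk v))).flip) (by
    rintro u ⟨k, hk⟩
    refine LinearMap.ext fun U => ?_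
    obtain ⟨v, rfl⟩ := N.toHE_surjective U
    exact N.energy_of_consts hk v)

theorem innerHE_toHE (u v : N.dom) : N.innerHE (N.toHE u) (N.toHE v) = N.energy u v := rfl

theorem innerHE_definite (U : N.HE) (h : N.innerHE U U = 0) : U = 0 := by
  obtain ⟨u, rfl⟩ := N.toHE_surjective U
  rw [innerHE_toHE] at h
  rw [toHE_eq_zero]
  rcases isEmpty_or_nonempty V with hV | ⟨⟨o⟩⟩
  · exact ⟨0, fun x => (hV.false x).elim⟩
  · refine ⟨(u : V → ℝ) o, fun x => ?_⟩
    obtain ⟨K, -, hK⟩ := N.exists_bound x o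
    have := hK u u.2
    rw [h, Real.sqrt_zero, mul_zero] at this
    exact sub_eq_zero.1 (abs_eq_zero.1 (le_antisymm this (abs_nonneg _)))

@[reducible]
noncomputable def coreHE : InnerProductSpace.Core ℝ N.HE where
  inner U W := N.innerHE U W
  conj_inner_symm U W := by
    obtain ⟨u, rfl⟩ := N.toHE_surjective U
    obtain ⟨w, rfl⟩ := N.toHE_surjective W
    exact N.energy_comm _ _
  re_inner_nonneg U := by
    obtain ⟨u, rfl⟩ := N.toHE_surjective U
    exact N.energy_nonneg _
  add_left U U' W := by simp
  smul_left U W a := by simp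
  definite U h := N.innerHE_definite U h

noncomputable instance : NormedAddCommGroup N.HE :=
  @InnerProductSpace.Core.toNormedAddCommGroup ℝ N.HE _ _ _ N.coreHE

noncomputable instance : InnerProductSpace ℝ N.HE :=
  InnerProductSpace.ofCore N.coreHE.toCore

theorem inner_toHE (u v : N.dom) :
    inner ℝ (N.toHE u) (N.toHE v) = N.energy u v := rfl

theorem norm_toHE (u : N.dom) : ‖N.toHE u‖ = Real.sqrt (N.energy u u) := by
  rw [norm_eq_sqrt_real_inner, inner_toHE]

/-- The functional `L_xy u = u x - u y` on the energy space. -/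
noncomputable def diff (x y : V) : N.HE →L[ℝ] ℝ :=
  LinearMap.mkContinuousOfExistsBound
    (N.consts.liftQ
      ({ toFun := fun u => (u : V → ℝ) x - (u : V → ℝ) y
         map_add' := fun u v => by simp only [Submodule.coe_add, Pi.add_apply]; ring
         map_smul' := fun a u => by
          simp only [Submodule.coe_smul, Pi.smul_apply, smul_eq_mul, RingHom.id_apply]; ring } :
        N.dom →ₗ[ℝ] ℝ) (by
        rintro u ⟨k, hk⟩
        simp [hk]) : N.HE →ₗ[ℝ] ℝ) (by
    obtain ⟨K, -, hK⟩ := N.exists_bound x y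
    refine ⟨K, fun U => ?_⟩
    obtain ⟨u, rfl⟩ := N.toHE_surjective U
    rw [norm_toHE]
    exact hK u u.2)

theorem diff_toHE (x y : V) (u : N.dom) :
    N.diff x y (N.toHE u) = (u : V → ℝ) x - (u : V → ℝ) y := rfl

/-- Every class has a representative that vanishes at a given vertex. -/
theorem exists_rep (o : V) (U : N.HE) :
    ∃ u : N.dom, N.toHE u = U ∧ (u : V → ℝ) o = 0 := by
  obtain ⟨u, rfl⟩ := N.toHE_surjective U
  have hk : (fun _ => (u : V → ℝ) o : V → ℝ) ∈ N.dom := by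
    change Summable _
    simp
  refine ⟨u - ⟨_, hk⟩, ?_, by simp⟩
  rw [map_sub, sub_eq_self, toHE_eq_zero]
  exact ⟨_, fun x => rfl⟩

/-- A pointwise limit of functions whose energies are bounded by `E` has energy at most `E`. -/
theorem energy_le_of_tendsto {w : ℕ → V → ℝ} {u : V → ℝ} {E : ℝ} (hw : ∀ n, w n ∈ N.dom)
    (hE : ∀ᶠ n in Filter.atTop, N.energy (w n) (w n) ≤ E)
    (hlim : ∀ x, Filter.Tendsto (fun n => w n x) Filter.atTop (nhds (u x))) :
    u ∈ N.dom ∧ N.energy u u ≤ E := by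
  have hpart : ∀ F : Finset (V × V), ∑ p ∈ F, N.c p.1 p.2 * (u p.1 - u p.2) ^ 2 ≤ 2 * E := by
    intro F
    refine le_of_tendsto (tendsto_finsetSum F fun p _ =>
      (((hlim p.1).sub (hlim p.2)).pow 2).const_mul (N.c p.1 p.2)) ?_
    filter_upwards [hE] with n hn
    have h := (hw n : Summable _).sum_le_tsum F
      (fun p _ => mul_nonneg (N.nonneg p.1 p.2) (sq_nonneg _))
    refine h.trans ?_
    unfold energy at hn
    simp only [← pow_two] at hn
    linarith
  have hu : Summable fun p : V × V => N.c p.1 p.2 * (u p.1 - u p.2) ^ 2 :=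
    summable_of_sum_le (fun p => mul_nonneg (N.nonneg _ _) (sq_nonneg _)) hpart
  refine ⟨hu, ?_⟩
  have h := hu.tsum_le_of_sum_le hpart
  unfold energy
  simp only [← pow_two]
  linarith

instance : CompleteSpace N.HE := by
  rcases isEmpty_or_nonempty V with hV | ⟨⟨o⟩⟩
  · have : Subsingleton N.HE := ⟨fun U W => by
      obtain ⟨u, rfl⟩ := N.toHE_surjective U
      obtain ⟨w, rfl⟩ := N.toHE_surjective W
      exact congrArg _ (Subsingleton.elim u w)⟩
    infer_instance
  refine Metric.complete_of_cauchySeq_tendsto fun U hU => ?_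
  choose u hu huo using fun n => N.exists_rep o (U n)
  have hval : ∀ n x, N.diff x o (U n) = (u n : V → ℝ) x := fun n x => by
    rw [← hu n, diff_toHE, huo, sub_zero]
  have hex : ∀ x, ∃ l, Filter.Tendsto (fun n => (u n : V → ℝ) x) Filter.atTop (nhds l) := by
    intro x
    simp only [← hval]
    exact cauchySeq_tendsto_of_complete
      (hU.map (N.diff x o).uniformContinuous)
  choose l hl using hex
  have key : ∀ ε > 0, ∃ n₀, ∀ n ≥ n₀, ((u n : V → ℝ) - l) ∈ N.dom ∧
      N.energy ((u n : V → ℝ) - l) ((u n : V → ℝ) - l) ≤ ε ^ 2 := by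
    intro ε hε
    obtain ⟨n₀, hn₀⟩ := Metric.cauchySeq_iff.1 hU ε hε
    refine ⟨n₀, fun n hn => ?_⟩
    refine N.energy_le_of_tendsto (w := fun m => ((u n - u m : N.dom) : V → ℝ))
      (fun m => (u n - u m).2) ?_ (fun x => ?_)
    · filter_upwards [Filter.eventually_ge_atTop n₀] with m hm
      have h := (hn₀ n hn m hm).le
      rw [dist_eq_norm, ← hu n, ← hu m, ← map_sub, norm_toHE] at h
      exact (Real.sqrt_le_left hε.le).1 h
    · simpa using (hl x).const_sub ((u n : V → ℝ) x)
  obtain ⟨n₁, hn₁⟩ := key 1 one_pos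
  have hldom : l ∈ N.dom := by
    simpa using N.dom.sub_mem (u n₁).2 (hn₁ n₁ le_rfl).1
  refine ⟨N.toHE ⟨l, hldom⟩, Metric.tendsto_atTop.2 fun ε hε => ?_⟩
  obtain ⟨n₀, hn₀⟩ := key (ε / 2) (half_pos hε)
  refine ⟨n₀, fun n hn => ?_⟩
  rw [dist_eq_norm, ← hu n, ← map_sub, norm_toHE]
  refine lt_of_le_of_lt ?_ (half_lt_self hε)
  exact (Real.sqrt_le_left (half_pos hε).le).2 (hn₀ n hn).2

/-! ### Energy kernel, finitely supported functions, harmonic functions -/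

/-- The energy kernel: the element `v_x` with `⟪v_x, u⟫ = u x - u o` for all `u`, where `o` is the
reference vertex. -/
noncomputable def energyKernel (o x : V) : N.HE :=
  (InnerProductSpace.toDual ℝ N.HE).symm (N.diff x o)

theorem inner_energyKernel (o x : V) (u : N.dom) :
    inner ℝ (N.energyKernel o x) (N.toHE u) = (u : V → ℝ) x - (u : V → ℝ) o := by
  rw [energyKernel, InnerProductSpace.toDual_symm_apply, diff_toHE]

theorem hasSum_row (x : V) {f : V × V → ℝ} (hf : Summable fun y => f (x, y)) :
    HasSum (fun p : V × V => dirac x p.1 * f p) (∑' y, f (x, y)) := by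
  have hinj : Function.Injective (fun y : V => (x, y)) := fun a b h => (Prod.mk.inj h).2
  refine (hinj.hasSum_iff ?_).1 ?_
  · rintro ⟨a, b⟩ hab
    have : a ≠ x := fun h => hab ⟨b, by rw [h]⟩
    simp [dirac, this]
  · have : ((fun p : V × V => dirac x p.1 * f p) ∘ fun y => (x, y)) = fun y => f (x, y) := by
      funext y
      simp [dirac]
    rw [this]
    exact hf.hasSum

theorem dirac_mem (x : V) : dirac x ∈ N.dom := by
  have h1 := (hasSum_row x (f := fun p => N.c p.1 p.2) (N.summable x)).summable
  have h2 := ((Equiv.prodComm V V).summable_iff).2 h1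
  refine Summable.of_nonneg_of_le (fun p => mul_nonneg (N.nonneg _ _) (sq_nonneg _)) (fun p => ?_)
    (h1.add h2)
  have hp := N.nonneg p.1 p.2
  have hs := N.symm p.2 p.1
  simp only [Function.comp, Equiv.prodComm_apply, Prod.fst_swap, Prod.snd_swap, hs]
  by_cases ha : p.1 = x <;> by_cases hb : p.2 = x <;> simp [dirac, ha, hb] <;>
    simpa [ha, hb] using hp

/-- The class of the Dirac mass at `x`. -/
noncomputable def diracHE (x : V) : N.HE := N.toHE ⟨dirac x, N.dirac_mem x⟩

theorem summable_laplacian {u : V → ℝ} (hu : u ∈ N.dom) (x : V) :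
    Summable fun y => N.c x y * (u x - u y) := by
  have hinj : Function.Injective (fun y : V => (x, y)) := fun a b h => (Prod.mk.inj h).2
  refine Summable.of_norm_bounded ((N.summable x).add
    ((hu : Summable _).comp_injective hinj)) (fun y => ?_)
  rw [Real.norm_eq_abs, abs_mul, abs_of_nonneg (N.nonneg _ _)]
  have h : |u x - u y| ≤ 1 + (u x - u y) ^ 2 := by
    rw [abs_le]
    constructor <;> nlinarith [sq_nonneg (u x - u y - 1), sq_nonneg (u x - u y + 1)]
  calc _ ≤ N.c x y * (1 + (u x - u y) ^ 2) := mul_le_mul_of_nonneg_left h (N.nonneg _ _)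
    _ = _ := by simp only [Function.comp]; ring

theorem inner_diracHE (x : V) (u : N.dom) :
    inner ℝ (N.diracHE x) (N.toHE u) = laplacian N.c u x := by
  rw [diracHE, inner_toHE]
  have h1 := hasSum_row x (f := fun p => N.c p.1 p.2 * ((u : V → ℝ) p.1 - (u : V → ℝ) p.2))
    (N.summable_laplacian u.2 x)
  have h2 := ((Equiv.prodComm V V).hasSum_iff).2 h1
  have h3 := (h1.add h2).tsum_eq
  unfold energy laplacian
  rw [one_div, inv_mul_eq_iff_eq_mul₀ two_ne_zero, two_mul]
  refine Eq.trans (tsum_congr fun p => ?_) h3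
  have hs := N.symm p.2 p.1
  simp only [Function.comp, Equiv.prodComm_apply, Prod.fst_swap, Prod.snd_swap, hs]
  ring

/-- The closure of the classes of finitely supported functions. -/
noncomputable def finSpace : Submodule ℝ N.HE :=
  (Submodule.span ℝ (Set.range N.diracHE)).topologicalClosure

/-- The classes of harmonic functions of finite energy. -/
noncomputable def harmSpace : Submodule ℝ N.HE where
  carrier := {U | ∃ u : N.dom, N.toHE u = U ∧ ∀ x, laplacian N.c u x = 0}
  zero_mem' := ⟨0, map_zero _, fun x => by simp [laplacian]⟩
  add_mem' := by
    rintro _ _ ⟨u, rfl, hu⟩ ⟨v, rfl, hv⟩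
    refine ⟨u + v, map_add _ _ _, fun x => ?_⟩
    rw [← inner_diracHE, map_add, inner_add_right, inner_diracHE, inner_diracHE, hu, hv, add_zero]
  smul_mem' := by
    rintro a _ ⟨u, rfl, hu⟩
    refine ⟨a • u, map_smul _ _ _, fun x => ?_⟩
    rw [← inner_diracHE, map_smul, inner_smul_right, inner_diracHE, hu, mul_zero]

theorem isClosed_harmSpace : IsClosed (N.harmSpace : Set N.HE) := by
  have : (N.harmSpace : Set N.HE) = ⋂ x : V, {U | inner ℝ (N.diracHE x) U = 0} := by
    ext U
    obtain ⟨u, rfl⟩ := N.toHE_surjective U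
    simp only [Set.mem_iInter, Set.mem_ofPred_eq, inner_diracHE]
    constructor
    · rintro ⟨w, hw, h⟩ x
      rw [← inner_diracHE, ← hw, inner_diracHE]
      exact h x
    · exact fun h => ⟨u, rfl, h⟩
  rw [this]
  exact isClosed_iInter fun x => isClosed_eq (by fun_prop) continuous_const

instance : CompleteSpace N.harmSpace := N.isClosed_harmSpace.completeSpace_coe

/-- `h_x`, the orthogonal projection of `v_x` to the harmonic functions. -/
noncomputable def harmKernel (o x : V) : N.HE := N.harmSpace.starProjection (N.energyKernel o x)

end ResistanceNetwork

/-! Let `w = energyKernel y x`, the Riesz representative of `L_xy`; it equals `v_x - v_y` for every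
reference vertex. For a closed subspace `K` with orthogonal projection `P`, the vector `P w`
represents `L_xy` on `K`. By Cauchy–Schwarz, with equality at multiples of `P w`, the number `‖P
w‖²` is at once `L_xy (P w)`, the best constant in `L_xy² ≤ κ ℰ` on `K`, the squared norm of `L_xy`
on `K`, and, if positive, the reciprocal of the least energy in `K` with boundary values 1 at `x`
and 0 at `y`.

It remains to identify the two limits: `R^F` is `‖w‖²` (`isFreeResistance`) and `R^W` is `‖P w‖²`
for `K = Fin` (`isWiredResistance`). Since `Harm` is the orthogonal complement of `Fin`
(`orthogonal_finSpace`), Pythagoras turns `R^F - R^W` into `‖P w‖²` for `K = Harm`, and every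
formula follows.

A finite effective resistance is the squared norm of the kernel of that network
(`effectiveResistance_eq`). Free resistances dominate `‖w‖²` by Rayleigh monotonicity; conversely a
pointwise limit of the free potentials has voltage drop `l` and energy at most `l`, where `l` is the
limit resistance, so `l² ≤ ‖w‖² l`. Functions on a wired network are functions on `V` that are
constant off a finite set, with the same energy. Hence wired resistances are bounded by the value
for `Fin`, and in the limit they control `L_xy` on all finitely supported functions, thus on their
closure. -/

namespace ResistanceNetwork

variable {V : Type*} (N : ResistanceNetwork V)

/-! ### The energy kernel and orthogonal projections -/

/-- `energyKernel o x` represents the functional `L_xo`. -/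
theorem inner_energyKernel_eq_diff (o x : V) (U : N.HE) :
    inner ℝ (N.energyKernel o x) U = N.diff x o U := by
  rw [energyKernel, InnerProductSpace.toDual_symm_apply]

theorem energyKernel_sub_energyKernel (o x y : V) :
    N.energyKernel o x - N.energyKernel o y = N.energyKernel y x := by
  refine ext_inner_right ℝ fun U => ?_
  obtain ⟨u, rfl⟩ := N.toHE_surjective U
  simp only [inner_sub_left, inner_energyKernel_eq_diff, diff_toHE]
  ring

theorem harmKernel_sub_harmKernel (o x y : V) :
    N.harmKernel o x - N.harmKernel o y = N.harmSpace.starProjection (N.energyKernel y x) := by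
  rw [harmKernel, harmKernel, ← map_sub, energyKernel_sub_energyKernel]

theorem norm_sq_toHE (u : N.dom) : ‖N.toHE u‖ ^ 2 = N.energy u u := by
  rw [norm_toHE, Real.sq_sqrt (N.energy_nonneg _)]

section Projection

variable (K : Submodule ℝ N.HE) [K.HasOrthogonalProjection]

theorem inner_starProjection_energyKernel (x y : V) {U : N.HE} (hU : U ∈ K) :
    inner ℝ (K.starProjection (N.energyKernel y x)) U = N.diff x y U := by
  rw [Submodule.inner_starProjection_left_eq_right, Submodule.starProjection_eq_self_iff.2 hU,
    inner_energyKernel_eq_diff]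

theorem diff_starProjection_energyKernel (x y : V) :
    N.diff x y (K.starProjection (N.energyKernel y x)) =
      ‖K.starProjection (N.energyKernel y x)‖ ^ 2 := by
  rw [← N.inner_starProjection_energyKernel K x y (Submodule.starProjection_apply_mem _ _),
    real_inner_self_eq_norm_sq]

theorem diff_sq_le (x y : V) {U : N.HE} (hU : U ∈ K) :
    N.diff x y U ^ 2 ≤ ‖K.starProjection (N.energyKernel y x)‖ ^ 2 * ‖U‖ ^ 2 := by
  rw [← N.inner_starProjection_energyKernel K x y hU, ← mul_pow, ← sq_abs]
  exact pow_le_pow_left₀ (abs_nonneg _) (abs_real_inner_le_norm _ _) 2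

theorem starProjection_energyKernel_pos {x y : V} {U : N.HE} (hU : U ∈ K)
    (h : N.diff x y U ≠ 0) : 0 < ‖K.starProjection (N.energyKernel y x)‖ ^ 2 := by
  refine (sq_nonneg _).lt_of_ne fun h0 => h ?_
  have := N.diff_sq_le K x y hU
  rw [← h0, zero_mul] at this
  exact pow_eq_zero_iff two_ne_zero |>.1 (le_antisymm this (sq_nonneg _))

/-- Cauchy–Schwarz bounds the energy of a competitor below, and a rescaled representative of the
projected kernel attains the bound. -/
theorem isLeast_energy {x y : V} (h : 0 < ‖K.starProjection (N.energyKernel y x)‖ ^ 2) :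
    IsLeast {e : ℝ | ∃ u : N.dom, N.toHE u ∈ K ∧ (u : V → ℝ) x = 1 ∧ (u : V → ℝ) y = 0 ∧
      e = N.energy u u} (1 / ‖K.starProjection (N.energyKernel y x)‖ ^ 2) := by
  set w := K.starProjection (N.energyKernel y x) with hw
  constructor
  -- The factor normalizes the voltage drop to 1, because `L_xy w = ‖w‖²`.
  · obtain ⟨u, hu, huy⟩ := N.exists_rep y ((‖w‖ ^ 2)⁻¹ • w)
    have hd := N.diff_toHE x y u
    rw [hu, map_smul, hw, diff_starProjection_energyKernel, ← hw, smul_eq_mul,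
      inv_mul_cancel₀ h.ne', huy, sub_zero] at hd
    refine ⟨u, ?_, hd.symm, huy, ?_⟩
    · rw [hu]
      exact K.smul_mem _ (Submodule.starProjection_apply_mem _ _)
    · rw [← norm_sq_toHE, hu, norm_smul, mul_pow, Real.norm_eq_abs, sq_abs]
      field_simp
  · rintro _ ⟨u, hu, hx, hy, rfl⟩
    have := N.diff_sq_le K x y hu
    rw [diff_toHE, hx, hy, norm_sq_toHE] at this
    rw [div_le_iff₀ h, mul_comm]
    simpa using this

theorem isLeast_bound (x y : V) :
    IsLeast {κ : ℝ | 0 ≤ κ ∧ ∀ u : N.dom, N.toHE u ∈ K →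
      |(u : V → ℝ) x - (u : V → ℝ) y| ^ 2 ≤ κ * N.energy u u}
      (‖K.starProjection (N.energyKernel y x)‖ ^ 2) := by
  refine ⟨⟨sq_nonneg _, fun u hu => ?_⟩, ?_⟩
  · rw [sq_abs, ← diff_toHE, ← norm_sq_toHE]
    exact N.diff_sq_le K x y hu
  · rintro κ ⟨hκ, h⟩
    obtain ⟨u, hu⟩ := N.toHE_surjective (K.starProjection (N.energyKernel y x))
    have := h u (hu ▸ Submodule.starProjection_apply_mem _ _)
    rw [sq_abs, ← diff_toHE, ← norm_sq_toHE, hu, diff_starProjection_energyKernel] at this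
    -- The extremal vector gives `a² ≤ κ a` with `a = ‖P w‖²`; cancelling `a` needs it nonzero.
    rcases (sq_nonneg ‖K.starProjection (N.energyKernel y x)‖).eq_or_lt with h0 | h0
    · rwa [← h0]
    · rw [sq (‖_‖ ^ 2)] at this
      exact le_of_mul_le_mul_right this h0

theorem isGreatest_diff_sq (x y : V) :
    IsGreatest {r : ℝ | ∃ u : N.dom, N.toHE u ∈ K ∧ N.energy u u ≤ 1 ∧
      r = |(u : V → ℝ) x - (u : V → ℝ) y| ^ 2}
      (‖K.starProjection (N.energyKernel y x)‖ ^ 2) := by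
  set w := K.starProjection (N.energyKernel y x) with hw
  constructor
  -- If `w = 0`, the convention `0⁻¹ = 0` makes this the zero class, which is still the right
  -- witness.
  · obtain ⟨u, hu⟩ := N.toHE_surjective (‖w‖⁻¹ • w)
    refine ⟨u, ?_, ?_, ?_⟩
    · rw [hu]
      exact K.smul_mem _ (Submodule.starProjection_apply_mem _ _)
    · rw [← norm_sq_toHE, hu, norm_smul, norm_inv, norm_norm]
      exact pow_le_one₀ (by positivity) inv_mul_le_one
    · rw [sq_abs, ← diff_toHE, hu, map_smul, hw, diff_starProjection_energyKernel, ← hw,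
        smul_eq_mul]
      rcases eq_or_ne ‖w‖ 0 with h0 | h0
      · simp [h0]
      · field_simp
  · rintro _ ⟨u, hu, h1, rfl⟩
    have := N.diff_sq_le K x y hu
    rw [diff_toHE, norm_sq_toHE] at this
    rw [sq_abs]
    exact this.trans (mul_le_of_le_one_right (sq_nonneg _) h1)

theorem norm_diff_comp_subtypeL (x y : V) :
    ‖(N.diff x y).comp K.subtypeL‖ = ‖K.starProjection (N.energyKernel y x)‖ := by
  refine le_antisymm (ContinuousLinearMap.opNorm_le_bound _ (norm_nonneg _) fun U => ?_) ?_
  · change ‖N.diff x y U‖ ≤ _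
    rw [← N.inner_starProjection_energyKernel K x y U.2]
    exact norm_inner_le_norm (𝕜 := ℝ) _ (U : N.HE)
  · set w := K.starProjection (N.energyKernel y x) with hw
    have := ((N.diff x y).comp K.subtypeL).le_opNorm
      ⟨w, Submodule.starProjection_apply_mem _ _⟩
    change ‖N.diff x y w‖ ≤ _ * ‖w‖ at this
    rw [hw, diff_starProjection_energyKernel, ← hw, norm_pow, norm_norm, sq] at this
    rcases (norm_nonneg w).eq_or_lt with h0 | h0
    · rw [← h0]
      exact norm_nonneg ((N.diff x y).comp K.subtypeL)
    · exact le_of_mul_le_mul_right this h0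

end Projection

/-! ### The Royden decomposition -/

theorem mem_harmSpace_iff (U : N.HE) :
    U ∈ N.harmSpace ↔ ∀ x, inner ℝ (N.diracHE x) U = 0 := by
  constructor
  · rintro ⟨u, rfl, hu⟩ x
    rw [inner_diracHE, hu]
  · intro h
    obtain ⟨u, rfl⟩ := N.toHE_surjective U
    exact ⟨u, rfl, fun x => by rw [← inner_diracHE, h]⟩

noncomputable instance : CompleteSpace N.finSpace :=
  (Submodule.isClosed_topologicalClosure _).completeSpace_coe

theorem diracHE_mem_finSpace (x : V) : N.diracHE x ∈ N.finSpace :=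
  Submodule.le_topologicalClosure _ (Submodule.subset_span ⟨x, rfl⟩)

/-- Pairing with a Dirac mass evaluates the Laplacian, so orthogonality to all Dirac masses is
harmonicity. -/
theorem orthogonal_finSpace : N.finSpaceᗮ = N.harmSpace := by
  ext U
  rw [finSpace, Submodule.orthogonal_closure, mem_harmSpace_iff, Submodule.mem_orthogonal]
  refine ⟨fun h x => h _ (Submodule.subset_span ⟨x, rfl⟩), fun h W hW => ?_⟩
  induction hW using Submodule.span_induction with
  | mem W hW => obtain ⟨x, rfl⟩ := hW; exact h x
  | zero => exact inner_zero_left _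
  | add W W' _ _ h1 h2 => rw [inner_add_left, h1, h2, add_zero]
  | smul a W _ h1 => rw [real_inner_smul_left, h1, mul_zero]

theorem norm_sq_sub_norm_sq_finSpace (U : N.HE) :
    ‖U‖ ^ 2 - ‖N.finSpace.starProjection U‖ ^ 2 = ‖N.harmSpace.starProjection U‖ ^ 2 := by
  have h := N.finSpace.norm_sq_eq_add_norm_sq_starProjection U
  have h' : N.finSpaceᗮ.starProjection U = N.harmSpace.starProjection U := by
    congr! 2
    exact N.orthogonal_finSpace
  rw [h'] at h
  linarith

/-! ### Functions that are constant off a finite set -/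

theorem dirac_self (x : V) : dirac x x = 1 := by simp [dirac]

theorem dirac_of_ne {x z : V} (h : z ≠ x) : dirac x z = 0 := by simp [dirac, h]

theorem dirac_comm (x z : V) : dirac x z = dirac z x := by
  rcases eq_or_ne z x with rfl | h
  · rfl
  · rw [dirac_of_ne h, dirac_of_ne h.symm]

theorem const_mem_dom (k : ℝ) : (fun _ => k : V → ℝ) ∈ N.dom := by
  change Summable _
  simp

theorem eq_sum_dirac {u : V → ℝ} {S : Finset V} {k : ℝ} (h : ∀ z ∉ S, u z = k) :
    u = (fun _ => k) + ∑ z ∈ S, (u z - k) • dirac z := by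
  classical
  funext w
  simp only [Pi.add_apply, Finset.sum_apply, Pi.smul_apply, smul_eq_mul]
  by_cases hw : w ∈ S
  · rw [Finset.sum_eq_single_of_mem w hw fun z _ hz => by rw [dirac_of_ne hz.symm, mul_zero],
      dirac_self]
    ring
  · rw [Finset.sum_eq_zero fun z hz => by
      rw [dirac_of_ne (ne_of_mem_of_not_mem hz hw).symm, mul_zero], h w hw, add_zero]

theorem mem_dom_of_const_off {u : V → ℝ} {S : Finset V} {k : ℝ} (h : ∀ z ∉ S, u z = k) :
    u ∈ N.dom := by
  rw [eq_sum_dirac h]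
  exact N.dom.add_mem (N.const_mem_dom k)
    (N.dom.sum_mem fun z _ => N.dom.smul_mem _ (N.dirac_mem z))

theorem toHE_of_const_off (u : N.dom) {S : Finset V} {k : ℝ}
    (h : ∀ z ∉ S, (u : V → ℝ) z = k) :
    N.toHE u = ∑ z ∈ S, ((u : V → ℝ) z - k) • N.diracHE z := by
  have hu : u = (⟨_, N.const_mem_dom k⟩ : N.dom) +
      ∑ z ∈ S, ((u : V → ℝ) z - k) • (⟨dirac z, N.dirac_mem z⟩ : N.dom) := by
    refine Subtype.ext ((eq_sum_dirac h).trans ?_)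
    simp
  conv_lhs => rw [hu]
  rw [map_add, (N.toHE_eq_zero _).2 ⟨k, fun _ => rfl⟩, zero_add, map_sum]
  exact Finset.sum_congr rfl fun z _ => map_smul _ _ _

/-- Green's formula without boundary term: the constant dies in the quotient, and what remains is a
finite combination of Dirac masses. -/
theorem energy_of_const_off (u w : N.dom) {S : Finset V} {k : ℝ}
    (h : ∀ z ∉ S, (u : V → ℝ) z = k) :
    N.energy u w = ∑ z ∈ S, ((u : V → ℝ) z - k) * laplacian N.c w z := by
  rw [← inner_toHE, N.toHE_of_const_off u h, sum_inner]
  exact Finset.sum_congr rfl fun z _ => by rw [real_inner_smul_left, inner_diracHE]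

/-! ### Effective resistance of finite networks -/

theorem mem_dom_of_finite [Finite V] (u : V → ℝ) : u ∈ N.dom :=
  have := Fintype.ofFinite V
  N.mem_dom_of_const_off (S := Finset.univ) (k := 0) fun z hz => (hz (Finset.mem_univ z)).elim

/-- The Riesz representative supplies a voltage function, and by Green's formula every voltage
function represents the same class. Hence the choice made by `Classical.epsilon` is immaterial. -/
theorem effectiveResistance_eq [Finite V] (x y : V) :
    effectiveResistance N.c x y = ‖N.energyKernel y x‖ ^ 2 := by
  have := Fintype.ofFinite V
  have hex : ∃ r : ℝ, ∃ v : V → ℝ,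
      (∀ z, laplacian N.c v z = dirac x z - dirac y z) ∧ r = v x - v y := by
    obtain ⟨v, hv⟩ := N.toHE_surjective (N.energyKernel y x)
    refine ⟨_, v, fun z => ?_, rfl⟩
    rw [← inner_diracHE, hv, real_inner_comm, inner_energyKernel_eq_diff, diracHE, diff_toHE]
    rw [dirac_comm x, dirac_comm y]
  obtain ⟨v, hv, hr⟩ := Classical.epsilon_spec hex
  change effectiveResistance N.c x y = _ at hr
  have hker : N.energyKernel y x = N.toHE ⟨v, N.mem_dom_of_finite v⟩ := by
    refine ext_inner_right ℝ fun U => ?_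
    obtain ⟨u, rfl⟩ := N.toHE_surjective U
    rw [inner_energyKernel, inner_toHE, energy_comm,
      N.energy_of_const_off u _ (S := Finset.univ) (k := 0)
        fun z hz => (hz (Finset.mem_univ z)).elim]
    simp only [hv, mul_sub, Finset.sum_sub_distrib, sub_zero]
    congr 1 <;>
    · rw [Finset.sum_eq_single_of_mem _ (Finset.mem_univ _) fun z _ hz => by
        rw [dirac_of_ne hz, mul_zero], dirac_self, mul_one]
  have hd := N.inner_energyKernel_eq_diff y x (N.energyKernel y x)
  rw [real_inner_self_eq_norm_sq] at hd
  rw [hr, hd, hker, diff_toHE]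

open Filter Topology

/-! ### Comparison of networks -/

theorem diff_energyKernel (x y : V) :
    N.diff x y (N.energyKernel y x) = ‖N.energyKernel y x‖ ^ 2 := by
  rw [← inner_energyKernel_eq_diff, real_inner_self_eq_norm_sq]

theorem sub_sq_le_energy {u : V → ℝ} (hu : u ∈ N.dom) (x y : V) :
    (u x - u y) ^ 2 ≤ ‖N.energyKernel y x‖ ^ 2 * N.energy u u := by
  have h := N.diff_sq_le ⊤ x y (U := N.toHE ⟨u, hu⟩) trivial
  rwa [norm_sq_toHE, Submodule.starProjection_top, diff_toHE] at h

theorem dom_comp {W : Type*} (M : ResistanceNetwork W) {φ : W → V}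
    (hφ : Function.Injective φ) (hc : ∀ a b, M.c a b ≤ N.c (φ a) (φ b)) {u : V → ℝ}
    (hu : u ∈ N.dom) : u ∘ φ ∈ M.dom :=
  Summable.of_nonneg_of_le (fun _ => mul_nonneg (M.nonneg _ _) (sq_nonneg _))
    (fun p => mul_le_mul_of_nonneg_right (hc p.1 p.2) (sq_nonneg _))
    ((hu : Summable _).comp_injective (hφ.prodMap hφ))

theorem energy_comp_le {W : Type*} (M : ResistanceNetwork W) {φ : W → V}
    (hφ : Function.Injective φ) (hc : ∀ a b, M.c a b ≤ N.c (φ a) (φ b)) {u : V → ℝ}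
    (hu : u ∈ N.dom) : M.energy (u ∘ φ) (u ∘ φ) ≤ N.energy u u := by
  have hM := N.dom_comp M hφ hc hu
  refine mul_le_mul_of_nonneg_left ?_ (by norm_num)
  exact Summable.tsum_le_tsum_of_inj (Prod.map φ φ) (hφ.prodMap hφ)
    (fun p _ => mul_nonneg (N.nonneg _ _) (mul_self_nonneg _))
    (fun p => mul_le_mul_of_nonneg_right (hc p.1 p.2) (mul_self_nonneg _))
    (M.summable_energy hM hM) (N.summable_energy hu hu)

/-- Rayleigh monotonicity: resistances increase when vertices are removed and conductances are
decreased. -/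
theorem norm_energyKernel_comp_le {W : Type*} (M : ResistanceNetwork W) {φ : W → V}
    (hφ : Function.Injective φ) (hc : ∀ a b, M.c a b ≤ N.c (φ a) (φ b)) (x y : W) :
    ‖N.energyKernel (φ y) (φ x)‖ ^ 2 ≤ ‖M.energyKernel y x‖ ^ 2 := by
  obtain ⟨u, hu⟩ := N.toHE_surjective (N.energyKernel (φ y) (φ x))
  have hd := N.diff_energyKernel (φ x) (φ y)
  have hE := N.norm_sq_toHE u
  rw [hu] at hE
  -- The potential of the larger network is tested in the smaller one: with `R_N`, `R_M` the two
  -- resistances, this leads to `R_N² ≤ R_M R_N`.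
  have h := M.sub_sq_le_energy (N.dom_comp M hφ hc u.2) x y
  have h' := mul_le_mul_of_nonneg_left (N.energy_comp_le M hφ hc u.2)
    (sq_nonneg ‖M.energyKernel y x‖)
  rw [← hu, diff_toHE, hu] at hd
  simp only [Function.comp_apply, hd] at h
  rw [← hE] at h'
  rcases (sq_nonneg ‖N.energyKernel (φ y) (φ x)‖).eq_or_lt with h0 | h0
  · rw [← h0]
    exact sq_nonneg _
  · rw [sq (‖N.energyKernel (φ y) (φ x)‖ ^ 2)] at h
    exact le_of_mul_le_mul_right (h.trans h') h0

/-! ### Limits along ultrafilters -/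

theorem exists_tendsto_ultrafilter_of_bounded {ι : Type*} {f : ι → ℝ} (F : Ultrafilter ι)
    {B : ℝ} (h : ∀ᶠ k in (F : Filter ι), |f k| ≤ B) :
    ∃ l, Tendsto f F (𝓝 l) := by
  obtain ⟨l, -, hl⟩ := (isCompact_Icc (a := -B) (b := B)).ultrafilter_le_nhds (F.map f)
    (le_principal_iff.2 (h.mono fun k hk => abs_le.1 hk))
  exact ⟨l, hl⟩

/-- Boundedness gives a limit along every ultrafilter, so only its value has to be found. This
replaces diagonal subsequences when pointwise limits of potentials are needed. -/
theorem tendsto_of_forall_ultrafilter {ι : Type*} {f : ι → ℝ} {l : Filter ι} {B R : ℝ}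
    (hB : ∀ᶠ k in l, |f k| ≤ B)
    (h : ∀ F : Ultrafilter ι, (F : Filter ι) ≤ l → ∀ r, Tendsto f F (𝓝 r) → r = R) :
    Tendsto f l (𝓝 R) := by
  refine (tendsto_iff_ultrafilter _ _ _).2 fun F hF => ?_
  obtain ⟨r, hr⟩ := exists_tendsto_ultrafilter_of_bounded F (hF hB)
  exact h F hF r hr ▸ hr

theorem Exhaustion.verts_mono {N : ResistanceNetwork V} (G : N.Exhaustion) : Monotone G.verts :=
  monotone_nat_of_le_succ G.mono

theorem Exhaustion.eventually_mem {N : ResistanceNetwork V} (G : N.Exhaustion) (x : V) :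
    ∀ᶠ k in atTop, x ∈ G.verts k := by
  obtain ⟨j, hj⟩ := G.exhausts x
  exact (eventually_ge_atTop j).mono fun k hk => G.verts_mono hk hj

theorem Exhaustion.eventually_subset {N : ResistanceNetwork V} (G : N.Exhaustion)
    (S : Finset V) : ∀ᶠ k in atTop, S ⊆ G.verts k :=
  (S.eventually_all.2 fun x _ => G.eventually_mem x).mono fun _ h x hx => h x hx

theorem mem_dom_of_sum_le {u : V → ℝ} {E : ℝ}
    (h : ∀ F : Finset (V × V), ∑ p ∈ F, N.c p.1 p.2 * (u p.1 - u p.2) ^ 2 ≤ 2 * E) :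
    u ∈ N.dom ∧ N.energy u u ≤ E := by
  have hu : Summable fun p : V × V => N.c p.1 p.2 * (u p.1 - u p.2) ^ 2 :=
    summable_of_sum_le (fun p => mul_nonneg (N.nonneg _ _) (sq_nonneg _)) h
  refine ⟨hu, ?_⟩
  have := hu.tsum_le_of_sum_le h
  unfold energy
  simp only [← pow_two]
  linarith

/-! ### Free resistance -/

/-- The full subnetwork on a finite connected set of vertices. -/
def freeNetwork (H : Finset V) (hH : (N.graph.induce (H : Set V)).Connected) :
    ResistanceNetwork H where
  c := N.freeConductance H
  symm a b := N.symm a b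
  nonneg a b := N.nonneg a b
  loopless a := N.loopless a
  summable _ := (hasSum_fintype _).summable
  connected a b := (SimpleGraph.reachable_iff_reflTransGen a b).1 (hH.preconnected a b)

section Free

variable {H : Finset V}

theorem freeResistanceOn_eq (hH : (N.graph.induce (H : Set V)).Connected)
    {x y : V} (hx : x ∈ H) (hy : y ∈ H) :
    N.freeResistanceOn H x y = ‖(N.freeNetwork H hH).energyKernel ⟨y, hy⟩ ⟨x, hx⟩‖ ^ 2 := by
  rw [freeResistanceOn, dif_pos ⟨hx, hy⟩, ← effectiveResistance_eq]
  rfl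

theorem norm_energyKernel_le_freeResistanceOn (hH : (N.graph.induce (H : Set V)).Connected)
    {x y : V} (hx : x ∈ H) (hy : y ∈ H) :
    ‖N.energyKernel y x‖ ^ 2 ≤ N.freeResistanceOn H x y := by
  rw [N.freeResistanceOn_eq hH hx hy]
  exact N.norm_energyKernel_comp_le (N.freeNetwork H hH) Subtype.val_injective
    (fun _ _ => le_rfl) ⟨x, hx⟩ ⟨y, hy⟩

theorem freeResistanceOn_anti (hH : (N.graph.induce (H : Set V)).Connected)
    {H' : Finset V} (hH' : (N.graph.induce (H' : Set V)).Connected)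
    (hsub : H ⊆ H') {x y : V} (hx : x ∈ H) (hy : y ∈ H) :
    N.freeResistanceOn H' x y ≤ N.freeResistanceOn H x y := by
  rw [N.freeResistanceOn_eq hH hx hy, N.freeResistanceOn_eq hH' (hsub hx) (hsub hy)]
  exact (N.freeNetwork H' hH').norm_energyKernel_comp_le (N.freeNetwork H hH)
    (φ := fun a => ⟨a, hsub a.2⟩) (fun _ _ h => Subtype.ext (congrArg Subtype.val h :))
    (fun _ _ => le_rfl) ⟨x, hx⟩ ⟨y, hy⟩

/-- The potential is extended by 0 off `H` so that the potentials of all `G_k` live on `V` and can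
be compared pointwise; the energy is still that of the subnetwork. -/
theorem exists_freePotential (hH : (N.graph.induce (H : Set V)).Connected)
    {x y : V} (hx : x ∈ H) (hy : y ∈ H) :
    ∃ v : V → ℝ, v x = N.freeResistanceOn H x y ∧ v y = 0 ∧
      (N.freeNetwork H hH).energy (v ∘ (↑)) (v ∘ (↑)) = N.freeResistanceOn H x y := by
  obtain ⟨v, hv, hvy⟩ := (N.freeNetwork H hH).exists_rep ⟨y, hy⟩
    ((N.freeNetwork H hH).energyKernel ⟨y, hy⟩ ⟨x, hx⟩)
  have hval : ∀ a : H, Function.extend Subtype.val v.1 0 a = (v : H → ℝ) a :=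
    fun a => Subtype.val_injective.extend_apply _ _ a
  rw [N.freeResistanceOn_eq hH hx hy]
  refine ⟨Function.extend Subtype.val v.1 0, ?_, ?_, ?_⟩
  · have h := (N.freeNetwork H hH).diff_energyKernel ⟨x, hx⟩ ⟨y, hy⟩
    rw [← hv, diff_toHE, hvy, sub_zero, hv] at h
    exact (hval ⟨x, hx⟩).trans h
  · exact (hval ⟨y, hy⟩).trans hvy
  · rw [show Function.extend Subtype.val v.1 0 ∘ (↑) = (v : H → ℝ) from funext hval,
      ← norm_sq_toHE, hv]

theorem sum_le_freeNetwork_energy (hH : (N.graph.induce (H : Set V)).Connected)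
    (v : V → ℝ) {F : Finset (V × V)}
    (hF : ∀ p ∈ F, p.1 ∈ H ∧ p.2 ∈ H) :
    ∑ p ∈ F, N.c p.1 p.2 * (v p.1 - v p.2) ^ 2 ≤
      2 * (N.freeNetwork H hH).energy (v ∘ (↑)) (v ∘ (↑)) := by
  have hE : 2 * (N.freeNetwork H hH).energy (v ∘ (↑)) (v ∘ (↑)) =
      ∑ p ∈ H ×ˢ H, N.c p.1 p.2 * (v p.1 - v p.2) ^ 2 := by
    rw [energy, ← mul_assoc, mul_one_div_cancel two_ne_zero, one_mul, tsum_fintype,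
      Fintype.sum_prod_type, Finset.sum_product, ← Finset.sum_coe_sort H]
    refine Finset.sum_congr rfl fun a _ => ?_
    rw [← Finset.sum_coe_sort H]
    exact Finset.sum_congr rfl fun b _ => by rw [sq]; rfl
  rw [hE]
  exact Finset.sum_le_sum_of_subset_of_nonneg
    (fun p hp => Finset.mem_product.2 (hF p hp))
    (fun p _ _ => mul_nonneg (N.nonneg _ _) (sq_nonneg _))

theorem freeNetwork_energy_mono (hH : (N.graph.induce (H : Set V)).Connected)
    {H' : Finset V}
    (hH' : (N.graph.induce (H' : Set V)).Connected) (hsub : H ⊆ H') (v : V → ℝ) :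
    (N.freeNetwork H hH).energy (v ∘ (↑)) (v ∘ (↑)) ≤
      (N.freeNetwork H' hH').energy (v ∘ (↑)) (v ∘ (↑)) :=
  (N.freeNetwork H' hH').energy_comp_le (N.freeNetwork H hH)
    (φ := fun a => ⟨a, hsub a.2⟩) (fun _ _ h => Subtype.ext (congrArg Subtype.val h :))
    (fun _ _ => le_rfl) (mem_dom_of_finite _ (v ∘ Subtype.val))

end Free

theorem isFreeResistance (x y : V) : N.IsFreeResistance x y (‖N.energyKernel y x‖ ^ 2) := by
  intro G
  obtain ⟨k₀, hx₀, hy₀⟩ := ((G.eventually_mem x).and (G.eventually_mem y)).exists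
  have hx : ∀ k ≥ k₀, x ∈ G.verts k := fun k hk => G.verts_mono hk hx₀
  have hy : ∀ k ≥ k₀, y ∈ G.verts k := fun k hk => G.verts_mono hk hy₀
  set r := fun k => N.freeResistanceOn (G.verts k) x y with hr
  set R := ‖N.energyKernel y x‖ ^ 2 with hR
  have hRr : ∀ k ≥ k₀, R ≤ r k := fun k hk =>
    N.norm_energyKernel_le_freeResistanceOn (G.connected k) (hx k hk) (hy k hk)
  have hrB : ∀ k ≥ k₀, r k ≤ r k₀ := fun k hk =>
    N.freeResistanceOn_anti (G.connected k₀) (G.connected k) (G.verts_mono hk) hx₀ hy₀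
  have hR0 : 0 ≤ R := sq_nonneg _
  have hpot : ∀ k, ∃ v : V → ℝ, k₀ ≤ k → v x = r k ∧ v y = 0 ∧
      (N.freeNetwork _ (G.connected k)).energy (v ∘ (↑)) (v ∘ (↑)) = r k := by
    intro k
    by_cases hk : k₀ ≤ k
    · obtain ⟨v, hv⟩ := N.exists_freePotential (G.connected k) (hx k hk) (hy k hk)
      exact ⟨v, fun _ => hv⟩
    · exact ⟨0, fun h => (hk h).elim⟩
  choose v hv using hpot
  refine tendsto_of_forall_ultrafilter (B := r k₀) ?_ fun F hF l hl => ?_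
  · filter_upwards [eventually_ge_atTop k₀] with k hk
    rw [abs_of_nonneg (hR0.trans (hRr k hk))]
    exact hrB k hk
  -- For fixed `z`, one subnetwork `G_j` containing `z` and `y` bounds `v k z` for all `k ≥ j`: the
  -- energy on `G_j` is at most that on `G_k`, which is `r k ≤ r k₀`.
  have hlim : ∀ z, ∃ a, Tendsto (fun k => v k z) F (𝓝 a) := by
    intro z
    obtain ⟨j, hzj, hjk⟩ := ((G.eventually_mem z).and (eventually_ge_atTop k₀)).exists
    obtain ⟨C, hC, hbound⟩ := (N.freeNetwork _ (G.connected j)).exists_bound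
      ⟨z, hzj⟩ ⟨y, hy j hjk⟩
    refine exists_tendsto_ultrafilter_of_bounded F (B := C * Real.sqrt (r k₀)) (hF ?_)
    filter_upwards [eventually_ge_atTop j] with k hk
    have hk₀ : k₀ ≤ k := hjk.trans hk
    have h := hbound (v k ∘ (↑)) (mem_dom_of_finite _ _)
    simp only [Function.comp_apply, (hv k hk₀).2.1, sub_zero] at h
    refine h.trans (mul_le_mul_of_nonneg_left (Real.sqrt_le_sqrt ?_) hC)
    refine (N.freeNetwork_energy_mono _ (G.connected k) (G.verts_mono hk) _).trans ?_
    rw [(hv k hk₀).2.2]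
    exact hrB k hk₀
  choose u hu using hlim
  have hF₀ : ∀ᶠ k in (F : Filter ℕ), k₀ ≤ k := hF (eventually_ge_atTop k₀)
  have hux : u x = l := tendsto_nhds_unique (hu x)
    (hl.congr' (hF₀.mono fun k hk => (hv k hk).1.symm))
  have huy : u y = 0 := tendsto_nhds_unique (hu y)
    (tendsto_const_nhds.congr' (hF₀.mono fun k hk => (hv k hk).2.1.symm))
  -- Fatou-type argument: every finite set of edges eventually lies in `G_k`, where its contribution
  -- is bounded by twice the energy `r k`.
  obtain ⟨hdom, hE⟩ := N.mem_dom_of_sum_le (u := u) (E := l) fun S => by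
    refine le_of_tendsto_of_tendsto (tendsto_finsetSum S fun p _ =>
      (((hu p.1).sub (hu p.2)).pow 2).const_mul (N.c p.1 p.2)) (hl.const_mul 2) ?_
    have hS : ∀ᶠ k in atTop, ∀ p ∈ S, p.1 ∈ G.verts k ∧ p.2 ∈ G.verts k :=
      S.eventually_all.2 fun p _ => (G.eventually_mem p.1).and (G.eventually_mem p.2)
    filter_upwards [hF hS, hF₀] with k hk hk₀
    rw [← (hv k hk₀).2.2]
    exact N.sum_le_freeNetwork_energy (G.connected k) (v k) hk
  have hRl : R ≤ l := ge_of_tendsto hl (hF₀.mono hRr)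
  refine le_antisymm ?_ hRl
  have h := (N.sub_sq_le_energy hdom x y).trans (mul_le_mul_of_nonneg_left hE hR0)
  rw [hux, huy, sub_zero, sq] at h
  rcases (hR0.trans hRl).eq_or_lt with h0 | h0
  · rwa [← h0]
  · exact le_of_mul_le_mul_right h h0

/-! ### Wired resistance -/

/-- A path from `a` to a vertex outside the finite set `H` must leave `H`. This is what connects the
wired vertex to the rest. -/
theorem exists_boundary_edge [Infinite V] {H : Finset V} {a : V} (ha : a ∈ H) :
    ∃ b ∈ H, ∃ z ∉ H, 0 < N.c b z := by
  obtain ⟨w, hw⟩ := Infinite.exists_notMem_finset H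
  by_contra! hcon
  refine hw ?_
  induction N.connected a w with
  | refl => exact ha
  | tail _ hbz ih =>
    by_contra hz
    exact (hcon _ (by_contra fun hb => hb (ih hb)) _ hz).not_gt hbz

/-- The wired subnetwork on a finite connected set of vertices. -/
noncomputable def wiredNetwork [Infinite V] (H : Finset V)
    (hH : (N.graph.induce (H : Set V)).Connected) : ResistanceNetwork (Option H) where
  c := N.wiredConductance H
  symm a b := by
    cases a <;> cases b <;> simp only [wiredConductance]
    exact N.symm _ _
  nonneg a b := by
    cases a <;> cases b <;> simp only [wiredConductance]
    · exact le_rfl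
    · exact tsum_nonneg fun z => N.nonneg _ _
    · exact tsum_nonneg fun z => N.nonneg _ _
    · exact N.nonneg _ _
  loopless a := by
    cases a <;> simp only [wiredConductance]
    exact N.loopless _
  summable _ := (hasSum_fintype _).summable
  connected := by
    have hsome : ∀ a b : H, Relation.ReflTransGen
        (fun p q => 0 < N.wiredConductance H p q) (some a) (some b) := fun a b =>
      Relation.ReflTransGen.lift (p := fun p q => 0 < N.wiredConductance H p q) some
        (fun _ _ h => h) _ _
        ((SimpleGraph.reachable_iff_reflTransGen a b).1 (hH.preconnected a b))
    obtain ⟨a₀⟩ := hH.nonempty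
    obtain ⟨b, hb, z, hz, hbz⟩ := N.exists_boundary_edge a₀.2
    have hpos : 0 < ∑' z : {z : V // z ∉ H}, N.c b z :=
      ((N.summable b).subtype _).tsum_pos (fun _ => N.nonneg _ _) ⟨z, hz⟩ hbz
    have h1 : ∀ a : H, Relation.ReflTransGen
        (fun p q => 0 < N.wiredConductance H p q) (some a) none := fun a =>
      (hsome a ⟨b, hb⟩).tail hpos
    have h2 : ∀ a : H, Relation.ReflTransGen
        (fun p q => 0 < N.wiredConductance H p q) none (some a) := fun a =>
      Relation.ReflTransGen.head (show 0 < N.wiredConductance H none (some ⟨b, hb⟩) from hpos)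
        (hsome ⟨b, hb⟩ a)
    rintro (_ | a) (_ | b)
    exacts [.refl, h2 b, h1 a, hsome a b]

open Classical in
/-- A function on the wired subnetwork, as a function on `V` that is constant off `H`. -/
noncomputable def unwire {H : Finset V} (u : Option H → ℝ) (z : V) : ℝ :=
  if h : z ∈ H then u (some ⟨z, h⟩) else u none

theorem unwire_of_mem {H : Finset V} (u : Option H → ℝ) (z : H) :
    unwire u (z : V) = u (some z) := by
  rw [unwire, dif_pos z.2]

theorem unwire_of_notMem {H : Finset V} (u : Option H → ℝ) {z : V} (h : z ∉ H) :
    unwire u z = u none := by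
  rw [unwire, dif_neg h]

theorem unwire_mem_dom {H : Finset V} (u : Option H → ℝ) : unwire u ∈ N.dom :=
  N.mem_dom_of_const_off fun _ => unwire_of_notMem u

theorem toHE_unwire_mem_span {H : Finset V} (u : Option H → ℝ) :
    N.toHE ⟨unwire u, N.unwire_mem_dom u⟩ ∈ Submodule.span ℝ (Set.range N.diracHE) := by
  rw [N.toHE_of_const_off _ fun _ => unwire_of_notMem u]
  exact Submodule.sum_mem _ fun z _ => Submodule.smul_mem _ _ (Submodule.subset_span ⟨z, rfl⟩)

/-- The row sum splits over `H` and its complement; on the complement the function is constant, so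
the conductances there add up to the one towards `none`. -/
theorem laplacian_unwire {H : Finset V} (u : Option H → ℝ) (z : H) :
    laplacian N.c (unwire u) z = laplacian (N.wiredConductance H) u (some z) := by
  rw [laplacian, laplacian, tsum_fintype (L := .unconditional _) (β := Option H),
    Fintype.sum_option, ← (N.summable_laplacian (N.unwire_mem_dom u) z).sum_add_tsum_subtype_compl H, add_comm,
    unwire_of_mem, ← Finset.sum_coe_sort H]
  congr 1
  · rw [wiredConductance, ← tsum_mul_right]
    exact tsum_congr fun w => by rw [unwire_of_notMem u w.2]
  · exact Finset.sum_congr rfl fun w _ => by rw [unwire_of_mem]; rfl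

section Wired

variable [Infinite V] {H : Finset V}

/-- Green's formula on both sides, with the value at `none` as the subtracted constant, so that
`none` itself contributes nothing. -/
theorem energy_unwire (hH : (N.graph.induce (H : Set V)).Connected)
    (u : Option H → ℝ) :
    N.energy (unwire u) (unwire u) = (N.wiredNetwork H hH).energy u u := by
  have h1 := N.energy_of_const_off ⟨_, N.unwire_mem_dom u⟩ ⟨_, N.unwire_mem_dom u⟩
    (fun _ => unwire_of_notMem u)
  have h2 := (N.wiredNetwork H hH).energy_of_const_off ⟨u, mem_dom_of_finite _ u⟩
    ⟨u, mem_dom_of_finite _ u⟩ (S := Finset.univ) (k := u none)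
    fun z hz => (hz (Finset.mem_univ z)).elim
  rw [Fintype.sum_option, sub_self, zero_mul, zero_add] at h2
  refine h1.trans (Eq.trans ?_ h2.symm)
  rw [← Finset.sum_coe_sort H]
  exact Finset.sum_congr rfl fun z _ => by
    rw [laplacian_unwire]
    exact congrArg (fun t => (t - u none) * _) (unwire_of_mem u z)

theorem wiredResistanceOn_eq (hH : (N.graph.induce (H : Set V)).Connected)
    {x y : V} (hx : x ∈ H) (hy : y ∈ H) :
    N.wiredResistanceOn H x y =
      ‖(N.wiredNetwork H hH).energyKernel (some ⟨y, hy⟩) (some ⟨x, hx⟩)‖ ^ 2 := by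
  rw [wiredResistanceOn, dif_pos ⟨hx, hy⟩, ← effectiveResistance_eq]
  rfl

theorem wiredResistanceOn_nonneg (hH : (N.graph.induce (H : Set V)).Connected)
    {x y : V} (hx : x ∈ H) (hy : y ∈ H) :
    0 ≤ N.wiredResistanceOn H x y := by
  rw [N.wiredResistanceOn_eq hH hx hy]
  exact sq_nonneg _

/-- The unwired potential lies in `Fin` and has voltage drop and energy both equal to the wired
resistance. -/
theorem wiredResistanceOn_le (hH : (N.graph.induce (H : Set V)).Connected)
    {x y : V} (hx : x ∈ H) (hy : y ∈ H) :
    N.wiredResistanceOn H x y ≤ ‖N.finSpace.starProjection (N.energyKernel y x)‖ ^ 2 := by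
  set M := N.wiredNetwork H hH
  obtain ⟨u, hu⟩ := M.toHE_surjective (M.energyKernel (some ⟨y, hy⟩) (some ⟨x, hx⟩))
  have hd := M.diff_energyKernel (some ⟨x, hx⟩) (some ⟨y, hy⟩)
  have hE := M.norm_sq_toHE u
  have h := N.diff_sq_le N.finSpace x y
    (Submodule.le_topologicalClosure _ (N.toHE_unwire_mem_span (u : Option H → ℝ)))
  rw [← hu, diff_toHE] at hd
  rw [diff_toHE, norm_sq_toHE, N.energy_unwire hH, ← hE] at h
  simp only at h
  rw [unwire_of_mem _ ⟨x, hx⟩, unwire_of_mem _ ⟨y, hy⟩, hd, hu,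
    ← N.wiredResistanceOn_eq hH hx hy, sq] at h
  rcases (N.wiredResistanceOn_nonneg hH hx hy).eq_or_lt with h0 | h0
  · rw [← h0]
    exact sq_nonneg _
  · exact le_of_mul_le_mul_right h h0

theorem sub_sq_le_wiredResistanceOn (hH : (N.graph.induce (H : Set V)).Connected)
    {x y : V} (hx : x ∈ H) (hy : y ∈ H) (u : Option H → ℝ) :
    (unwire u x - unwire u y) ^ 2 ≤
      N.wiredResistanceOn H x y * N.energy (unwire u) (unwire u) := by
  rw [N.wiredResistanceOn_eq hH hx hy, N.energy_unwire hH, unwire_of_mem _ ⟨x, hx⟩,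
    unwire_of_mem _ ⟨y, hy⟩]
  exact sub_sq_le_energy _ (mem_dom_of_finite _ u) _ _

end Wired

theorem exists_finset_of_mem_span {U : N.HE}
    (hU : U ∈ Submodule.span ℝ (Set.range N.diracHE)) :
    ∃ (u : N.dom) (S : Finset V), N.toHE u = U ∧ ∀ z ∉ S, (u : V → ℝ) z = 0 := by
  classical
  induction hU using Submodule.span_induction with
  | mem U hU =>
    obtain ⟨x, rfl⟩ := hU
    exact ⟨_, {x}, rfl, fun z hz => dirac_of_ne (by simpa using hz)⟩
  | zero => exact ⟨0, ∅, map_zero _, fun _ _ => rfl⟩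
  | add U W _ _ h1 h2 =>
    obtain ⟨u, S, rfl, hS⟩ := h1
    obtain ⟨w, T, rfl, hT⟩ := h2
    refine ⟨u + w, S ∪ T, map_add _ _ _, fun z hz => ?_⟩
    rw [Finset.mem_union, not_or] at hz
    simp [hS z hz.1, hT z hz.2]
  | smul a U _ h =>
    obtain ⟨u, S, rfl, hS⟩ := h
    exact ⟨a • u, S, map_smul _ _ _, fun z hz => by simp [hS z hz]⟩

theorem isWiredResistance [Infinite V] (x y : V) :
    N.IsWiredResistance x y (‖N.finSpace.starProjection (N.energyKernel y x)‖ ^ 2) := by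
  intro G
  have hxy := (G.eventually_mem x).and (G.eventually_mem y)
  set R := ‖N.finSpace.starProjection (N.energyKernel y x)‖ ^ 2 with hR
  refine tendsto_of_forall_ultrafilter (B := R) ?_ fun F hF l hl => ?_
  · filter_upwards [hxy] with k hk
    rw [abs_of_nonneg (N.wiredResistanceOn_nonneg (G.connected k) hk.1 hk.2)]
    exact N.wiredResistanceOn_le (G.connected k) hk.1 hk.2
  have hxyF : ∀ᶠ k in (F : Filter ℕ), x ∈ G.verts k ∧ y ∈ G.verts k := hF hxy
  have hl0 : 0 ≤ l := ge_of_tendsto hl (hxyF.mono fun k hk =>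
    N.wiredResistanceOn_nonneg (G.connected k) hk.1 hk.2)
  have hlR : l ≤ R := le_of_tendsto hl (hxyF.mono fun k hk =>
    N.wiredResistanceOn_le (G.connected k) hk.1 hk.2)
  -- Once `G_k` contains the support, a finitely supported function is a function on the wired
  -- network with value 0 at the wired vertex.
  have hspan : ∀ U ∈ Submodule.span ℝ (Set.range N.diracHE),
      N.diff x y U ^ 2 ≤ l * ‖U‖ ^ 2 := by
    intro U hU
    obtain ⟨u, S, rfl, hS⟩ := N.exists_finset_of_mem_span hU
    refine ge_of_tendsto (hl.mul_const _) ?_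
    filter_upwards [hxyF, hF (G.eventually_subset S)] with k hk hSk
    have hu : (u : V → ℝ) =
        unwire (fun a : Option (G.verts k) => a.elim 0 fun z => (u : V → ℝ) z) := by
      funext z
      by_cases hz : z ∈ G.verts k
      · exact (unwire_of_mem (fun a : Option (G.verts k) => a.elim 0 fun z => (u : V → ℝ) z)
          ⟨z, hz⟩).symm
      · rw [unwire_of_notMem _ hz]
        exact hS z fun h => hz (hSk h)
    rw [diff_toHE, norm_sq_toHE, hu]
    exact N.sub_sq_le_wiredResistanceOn (G.connected k) hk.1 hk.2 _
  have hfin : N.finSpace.starProjection (N.energyKernel y x) ∈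
      closure (Submodule.span ℝ (Set.range N.diracHE) : Set N.HE) :=
    Submodule.starProjection_apply_mem N.finSpace _
  have hclosed : IsClosed {U : N.HE | N.diff x y U ^ 2 ≤ l * ‖U‖ ^ 2} :=
    isClosed_le (by fun_prop) (by fun_prop)
  -- The estimate is a closed condition, so it passes to the projected kernel in `Fin`, where it
  -- reads `R² ≤ l R`.
  have h := closure_minimal hspan hclosed hfin
  change N.diff x y _ ^ 2 ≤ _ at h
  rw [diff_starProjection_energyKernel, ← hR, sq] at h
  refine le_antisymm hlR ?_
  rcases (hl0.trans hlR).eq_or_lt with h0 | h0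
  · rwa [← h0]
  · exact le_of_mul_le_mul_right h h0

/-! ### Exhaustions -/

/-- Summable conductances have countable support, so every ball in the graph distance is countable,
and by connectedness balls around one vertex cover `V`. -/
theorem countable (N : ResistanceNetwork V) : Countable V := by
  rcases isEmpty_or_nonempty V with hV | ⟨⟨o⟩⟩
  · infer_instance
  let B : ℕ → Set V := fun n => Nat.rec {o} (fun _ S => ⋃ a ∈ S, Function.support (N.c a)) n
  have hB : ∀ n, (B n).Countable := by
    intro n
    induction n with
    | zero => exact Set.countable_singleton o
    | succ n ih => exact ih.biUnion fun a _ => (N.summable a).countable_support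
  have hmem : ∀ x, x ∈ ⋃ n, B n := by
    intro x
    induction N.connected o x with
    | refl => exact Set.mem_iUnion.2 ⟨0, rfl⟩
    | tail _ hbz ih =>
      obtain ⟨n, hn⟩ := Set.mem_iUnion.1 ih
      exact Set.mem_iUnion.2 ⟨n + 1, Set.mem_biUnion hn hbz.ne'⟩
  exact Set.countable_univ_iff.1 ((Set.countable_iUnion hB).mono fun x _ => hmem x)

theorem nonempty_exhaustion [Nonempty V] : Nonempty N.Exhaustion := by
  classical
  have := N.countable
  obtain ⟨e, he⟩ := exists_surjective_nat V
  have hpre : N.graph.Preconnected := fun a b =>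
    (SimpleGraph.reachable_iff_reflTransGen a b).2 (N.connected a b)
  -- Inserting `x` makes the set nonempty, so the extension to a finite connected set also applies
  -- to the initial `∅`.
  choose ext hsub hconn using fun (S : Finset V) (x : V) =>
    SimpleGraph.extend_finset_to_connected hpre (Finset.insert_nonempty x S)
  let K : ℕ → Finset V := fun n => Nat.rec (ext ∅ (e 0)) (fun m S => ext S (e (m + 1))) n
  refine ⟨⟨K, fun k => (Finset.subset_insert _ _).trans (hsub (K k) (e (k + 1))), fun x => ?_,
    fun k => ?_⟩⟩
  · obtain ⟨n, rfl⟩ := he x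
    refine ⟨n, ?_⟩
    cases n with
    | zero => exact hsub ∅ (e 0) (Finset.mem_insert_self _ _)
    | succ n => exact hsub (K n) (e (n + 1)) (Finset.mem_insert_self _ _)
  · cases k with
    | zero => exact hconn ∅ (e 0)
    | succ k => exact hconn (K k) (e (k + 1))

/-! ### Harmonic resistance as the squared norm of a projection -/

theorem freeResistance_eq (x y : V) : N.freeResistance x y = ‖N.energyKernel y x‖ ^ 2 := by
  have : Nonempty V := ⟨x⟩
  -- Without an exhaustion the limit condition would be vacuous and would not determine the chosen
  -- value.
  obtain ⟨G⟩ := N.nonempty_exhaustion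
  exact tendsto_nhds_unique (Classical.epsilon_spec ⟨_, N.isFreeResistance x y⟩ G)
    (N.isFreeResistance x y G)

theorem wiredResistance_eq [Infinite V] (x y : V) :
    N.wiredResistance x y = ‖N.finSpace.starProjection (N.energyKernel y x)‖ ^ 2 := by
  obtain ⟨G⟩ := N.nonempty_exhaustion
  exact tendsto_nhds_unique (Classical.epsilon_spec ⟨_, N.isWiredResistance x y⟩ G)
    (N.isWiredResistance x y G)

theorem harmonicResistance_eq [Infinite V] (x y : V) :
    N.harmonicResistance x y = ‖N.harmSpace.starProjection (N.energyKernel y x)‖ ^ 2 := by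
  rw [harmonicResistance, freeResistance_eq, wiredResistance_eq, norm_sq_sub_norm_sq_finSpace]

theorem diff_diracHE_ne_zero {x y : V} (h : x ≠ y) : N.diff x y (N.diracHE x) ≠ 0 := by
  rw [diracHE, diff_toHE]
  simp [dirac_self, dirac_of_ne h.symm]

end ResistanceNetwork

theorem mainTheorem3 {V : Type*} [Infinite V] (N : ResistanceNetwork V) (o x y : V) :
    Nonempty N.Exhaustion ∧
    N.IsFreeResistance x y (N.freeResistance x y) ∧
    N.IsWiredResistance x y (N.wiredResistance x y) ∧
    N.harmonicResistance x y =
      N.diff x y (N.harmKernel o x) - N.diff x y (N.harmKernel o y) ∧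
    N.harmonicResistance x y =
      inner ℝ (N.harmKernel o x - N.harmKernel o y) (N.harmKernel o x - N.harmKernel o y) ∧
    (x ≠ y → ∃ m m' : ℝ,
      IsLeast {e : ℝ | ∃ u : N.dom, (u : V → ℝ) x = 1 ∧ (u : V → ℝ) y = 0 ∧
        e = N.energy u u} m ∧
      IsLeast {e : ℝ | ∃ u : N.dom, N.toHE u ∈ N.finSpace ∧
        (u : V → ℝ) x = 1 ∧ (u : V → ℝ) y = 0 ∧ e = N.energy u u} m' ∧
      0 < m ∧ 0 < m' ∧
      N.harmonicResistance x y = 1 / m - 1 / m') ∧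
    IsGLB {κ : ℝ | 0 ≤ κ ∧ ∀ u : N.dom, N.toHE u ∈ N.harmSpace →
      |(u : V → ℝ) x - (u : V → ℝ) y| ^ 2 ≤ κ * N.energy u u} (N.harmonicResistance x y) ∧
    IsLUB {r : ℝ | ∃ u : N.dom, N.toHE u ∈ N.harmSpace ∧ N.energy u u ≤ 1 ∧
      r = |(u : V → ℝ) x - (u : V → ℝ) y| ^ 2} (N.harmonicResistance x y) ∧
    N.harmonicResistance x y = ‖(N.diff x y).comp N.harmSpace.subtypeL‖ ^ 2 := by
  refine ⟨N.nonempty_exhaustion, ?_, ?_, ?_, ?_, fun hxy => ?_, ?_, ?_, ?_⟩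
  · rw [N.freeResistance_eq]
    exact N.isFreeResistance x y
  · rw [N.wiredResistance_eq]
    exact N.isWiredResistance x y
  · rw [N.harmonicResistance_eq, ← map_sub, N.harmKernel_sub_harmKernel,
      N.diff_starProjection_energyKernel]
  · rw [N.harmonicResistance_eq, N.harmKernel_sub_harmKernel, real_inner_self_eq_norm_sq]
  -- The Dirac mass at `x` separates `x` from `y` and lies in `Fin`, so both projected kernels are
  -- nonzero; `K = ⊤` gives the unrestricted minimum.
  · have hne := N.diff_diracHE_ne_zero hxy
    have hpos := N.starProjection_energyKernel_pos ⊤ (x := x) (y := y) trivial hne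
    have hpos' := N.starProjection_energyKernel_pos N.finSpace (N.diracHE_mem_finSpace x) hne
    refine ⟨_, _, ?_, N.isLeast_energy N.finSpace hpos', one_div_pos.2 hpos,
      one_div_pos.2 hpos', ?_⟩
    · simpa using N.isLeast_energy ⊤ hpos
    · rw [one_div_one_div, one_div_one_div, Submodule.starProjection_top,
        ContinuousLinearMap.id_apply, N.norm_sq_sub_norm_sq_finSpace, N.harmonicResistance_eq]
  · rw [N.harmonicResistance_eq]
    exact (N.isLeast_bound N.harmSpace x y).isGLB
  · rw [N.harmonicResistance_eq]
    exact (N.isGreatest_diff_sq N.harmSpace x y).isLUB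
  · rw [N.harmonicResistance_eq, N.norm_diff_comp_subtypeL]
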